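/- Let $G$ be a locally compact group with left Haar measure, and let $\varphi:G\to\mathbb{C}$ be a continuous positive definite function of norm one (that is, $\|\varphi\|_\infty=\varphi(e)=1$). Let $\pi$ be a strongly continuous unitary representation of $G$ on a Hilbert space $H_\pi$ with a cyclic vector $\xi$ such that $\varphi(s)=\langle\pi(s)\xi,\xi\rangle$ for all $s\in G$, and let $(e_i)_{i\in I}$ be an orthonormal basis of $H_\pi$. Put $\xi_i(s)=\langle e_i,\pi(s)^*\xi\rangle$ (inner products are linear in the first variable), let $M_{\xi_i}$ be the operator of multiplication by $\xi_i$ on $L^2(G)$, and let $\widehat\Theta(\varphi):\mathcal{B}(L^2(G))\to\mathcal{B}(L^2(G))$ be the quantum channel given by the weak* convergent sum $$\widehat\Theta(\varphi)(x)=w^*\text{-}\sum_{i\in I}M_{\xi_i}\,x\,M_{\xi_i}^*,\qquad x\in\mathcal{B}(L^2(G)).$$ Then $\widehat\Theta(\varphi)$ is a unitary conjugation, i.e. there is a unitary $U\in\mathcal{B}(L^2(G))$ with $\widehat\Theta(\varphi)(x)=UxU^*$ for all $x\in\mathcal{B}(L^2(G))$, if and only if $\varphi$ is a character of $G$, i.e.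 a continuous homomorphism from $G$ into the unit circle. -/

import Mathlib

open MeasureTheory
open scoped ENNReal ComplexConjugate ComplexOrder InnerProductSpace

noncomputable section

universe u

namespace DualChannel

/-! ### Positive definite functions, characters, cyclic representations -/

section Group

variable {G : Type*} [Group G]

/-- `∑ᵢⱼ αᵢ (conj αⱼ) φ(sⱼ⁻¹ sᵢ) ≥ 0` (in particular real) for all finite families. -/
def IsPositiveDefinite (φ : G → ℂ) : Prop :=
  ∀ (n : ℕ) (α : Fin n → ℂ) (s : Fin n → G),
    0 ≤ ∑ i, ∑ j, α i * conj (α j) * φ ((s j)⁻¹ * s i)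

variable [TopologicalSpace G]

variable (G) in
/-- `𝒫₁(G)`: the continuous positive definite functions of supremum norm one. -/
def P₁ : Set (G → ℂ) :=
  {φ | Continuous φ ∧ IsPositiveDefinite φ ∧ ⨆ s, ‖φ s‖ = 1}

/-- `φ` is a character of `G`: a continuous homomorphism into the unit circle, that is,
a one-dimensional unitary representation. -/
def IsCharacter (φ : G → ℂ) : Prop :=
  ∃ χ : G →ₜ* Circle, ∀ s, φ s = χ s

end Group

/-- A unitary representation of `G` on the Hilbert space `H`: a homomorphism into the unitary
group of `H` that is continuous for the strong operator topology. -/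
structure UnitaryRep (G : Type*) [Group G] [TopologicalSpace G]
    (H : Type*) [NormedAddCommGroup H] [InnerProductSpace ℂ H] [CompleteSpace H] where
  /-- The underlying homomorphism. -/
  toHom : G →* unitary (H →L[ℂ] H)
  /-- Strong operator continuity. -/
  continuous_apply : ∀ v : H, Continuous fun s => (toHom s : H →L[ℂ] H) v

namespace UnitaryRep

variable {G : Type*} [Group G] [TopologicalSpace G]
variable {H : Type*} [NormedAddCommGroup H] [InnerProductSpace ℂ H] [CompleteSpace H]

/-- The unitary operator `π(s)`. -/
def op (π : UnitaryRep G H) (s : G) : H →L[ℂ] H := π.toHom s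

/-- `ξ` is a cyclic vector for `π`: the span of its orbit is dense. -/
def IsCyclic (π : UnitaryRep G H) (ξ : H) : Prop :=
  (Submodule.span ℂ (Set.range fun s => π.op s ξ)).topologicalClosure = ⊤

/-- `φ = (π, ξ)`: the vector `ξ` is cyclic for `π`, and `φ(s) = ⟨π(s)ξ, ξ⟩` for all `s`.
(Mathlib's inner product is linear in the second variable.) -/
def Represents (π : UnitaryRep G H) (ξ : H) (φ : G → ℂ) : Prop :=
  π.IsCyclic ξ ∧ ∀ s, φ s = ⟪ξ, π.op s ξ⟫_ℂ

lemma adjoint_op (π : UnitaryRep G H) (s : G) :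
    ContinuousLinearMap.adjoint (π.op s) = π.op s⁻¹ := by
  have h : star (π.toHom s) = π.toHom s⁻¹ := by
    rw [map_inv]; rfl
  calc ContinuousLinearMap.adjoint (π.op s) = ((star (π.toHom s) : unitary _) : H →L[ℂ] H) := rfl
    _ = π.op s⁻¹ := by rw [h]; rfl

lemma norm_op_apply (π : UnitaryRep G H) (s : G) (v : H) : ‖π.op s v‖ = ‖v‖ :=
  Unitary.norm_map (π.toHom s) v

end UnitaryRep

/-! ### Existence of the cyclic representation of a positive definite function -/

section Existence

variable {G : Type*} [Group G]

lemma IsPositiveDefinite.finsupp {φ : G → ℂ} (h : IsPositiveDefinite φ) (c : G →₀ ℂ) :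
    0 ≤ c.sum fun x a => c.sum fun y b => a * conj b * φ (y⁻¹ * x) := by
  have h1 := h c.support.card (fun i => c (c.support.equivFin.symm i))
    (fun i => c.support.equivFin.symm i)
  convert h1 using 1
  simp only [Finsupp.sum]
  rw [← Finset.sum_coe_sort, ← Equiv.sum_comp c.support.equivFin.symm]
  refine Finset.sum_congr rfl fun i _ => ?_
  rw [← Finset.sum_coe_sort, ← Equiv.sum_comp c.support.equivFin.symm]

lemma IsPositiveDefinite.map_inv {φ : G → ℂ} (h : IsPositiveDefinite φ) (s : G) :
    φ s⁻¹ = conj (φ s) := by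
  have h0 := (Complex.le_def.1 (h 1 ![1] ![1])).2
  have h1 := (Complex.le_def.1 (h 2 ![1, 1] ![s, 1])).2
  have h2 := (Complex.le_def.1 (h 2 ![1, Complex.I] ![s, 1])).2
  simp [Fin.sum_univ_two] at h0 h1 h2
  apply Complex.ext
  · simp; linarith
  · simp; linarith

variable [TopologicalSpace G]

/-- Every continuous positive definite function is of the form `(π, ξ)`. -/
theorem IsPositiveDefinite.exists_represents {G : Type u} [Group G] [TopologicalSpace G]
    [IsTopologicalGroup G] {φ : G → ℂ} (hc : Continuous φ) (h : IsPositiveDefinite φ) :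
    ∃ (H : Type u) (_ : NormedAddCommGroup H) (_ : InnerProductSpace ℂ H) (_ : CompleteSpace H)
      (π : UnitaryRep G H) (ξ : H), π.Represents ξ φ := by
  let K : Matrix G G (ℂ →L[ℂ] ℂ) := .of fun x y => φ (x⁻¹ * y) • ContinuousLinearMap.id ℂ ℂ
  have hK : K.PosSemidef := by
    have ht := (RKHS.posSemidef_tfae (K := K)).out 0 2
    refine ht.2 ⟨?_, fun c => ?_⟩
    · ext x y
      have : φ (x⁻¹ * y) = conj (φ (y⁻¹ * x)) := by
        rw [← h.map_inv]; simp
      have hid : star (ContinuousLinearMap.id ℂ ℂ) = ContinuousLinearMap.id ℂ ℂ :=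
        star_one (ℂ →L[ℂ] ℂ)
      simp [K, Matrix.conjTranspose_apply, this, hid]
    · have := (Complex.le_def.1 (h.finsupp c)).1
      simp only [Finsupp.sum, Complex.re_sum, Complex.zero_re] at this
      simp only [Finsupp.sum, map_sum]
      refine this.trans_eq (Finset.sum_congr rfl fun x _ => Finset.sum_congr rfl fun y _ => ?_)
      simp [K]
      ring
  have : Fact K.PosSemidef := ⟨hK⟩
  let v : G → RKHS.OfKernel K := fun x => RKHS.kerFun (RKHS.OfKernel K) x 1
  have hv : ∀ x y, ⟪v y, v x⟫_ℂ = φ (y⁻¹ * x) := fun x y => by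
    have := RKHS.kernel_inner (RKHS.OfKernel K) x y (1 : ℂ) (1 : ℂ)
    rw [RKHS.OfKernel.kernel_ofKernel] at this
    rw [← this]
    simp [K, ← h.map_inv]
  have hd : (Submodule.span ℂ (Set.range v)).topologicalClosure = ⊤ := by
    rw [eq_top_iff, ← RKHS.kerFun_dense (RKHS.OfKernel K)]
    refine Submodule.topologicalClosure_mono (Submodule.span_le.2 ?_)
    rintro _ ⟨x, c, rfl⟩
    have : RKHS.kerFun (RKHS.OfKernel K) x c = c • v x := by
      simp only [v]; rw [← map_smul]; simp
    rw [this]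
    exact Submodule.smul_mem _ _ (Submodule.subset_span ⟨x, rfl⟩)
  clear_value v
  let E : (G →₀ ℂ) →ₗ[ℂ] RKHS.OfKernel K := Finsupp.linearCombination ℂ v
  have hE : DenseRange E := by
    rw [DenseRange, ← LinearMap.coe_range, Finsupp.range_linearCombination]
    exact Submodule.dense_iff_topologicalClosure_eq_top.2 hd
  have hn : ∀ (s : G) (c : G →₀ ℂ),
      ‖E (Finsupp.domLCongr (R := ℂ) (M := ℂ) (Equiv.mulLeft s) c)‖ = ‖E c‖ := fun s c => by
    have key : ⟪E (Finsupp.domLCongr (R := ℂ) (M := ℂ) (Equiv.mulLeft s) c),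
        E (Finsupp.domLCongr (R := ℂ) (M := ℂ) (Equiv.mulLeft s) c)⟫_ℂ = ⟪E c, E c⟫_ℂ := by
      simp only [E, Finsupp.linearCombination_apply, Finsupp.domLCongr_apply,
        Finsupp.domCongr_apply, Finsupp.sum_equivMapDomain, Finsupp.sum_inner, Finsupp.inner_sum,
        hv, inner_smul_left, inner_smul_right, Equiv.coe_mulLeft, mul_inv_rev, mul_assoc,
        inv_mul_cancel_left]
    rw [inner_self_eq_norm_sq_to_K, inner_self_eq_norm_sq_to_K] at key
    have key' : ‖E (Finsupp.domLCongr (R := ℂ) (M := ℂ) (Equiv.mulLeft s) c)‖ ^ 2 = ‖E c‖ ^ 2 := by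
      exact_mod_cast key
    exact (sq_eq_sq₀ (norm_nonneg _) (norm_nonneg _)).1 key'
  let T : G → (RKHS.OfKernel K ≃ₗᵢ[ℂ] RKHS.OfKernel K) := fun s =>
    (Finsupp.domLCongr (R := ℂ) (M := ℂ) (Equiv.mulLeft s)).extendOfIsometry E E hE hE (hn s)
  have hTv : ∀ s x, T s (v x) = v (s * x) := fun s x => by
    have := (Finsupp.domLCongr (R := ℂ) (M := ℂ) (Equiv.mulLeft s)).extendOfIsometry_eq E E hE hE
      (hn s) (Finsupp.single x 1)
    simpa [E] using this
  have hext : ∀ A B : RKHS.OfKernel K →L[ℂ] RKHS.OfKernel K, (∀ x, A (v x) = B (v x)) → A = B :=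
    fun A B hAB => ContinuousLinearMap.ext_on
      (Submodule.dense_iff_topologicalClosure_eq_top.2 hd) (by rintro _ ⟨x, rfl⟩; exact hAB x)
  let ρ : G →* unitary (RKHS.OfKernel K →L[ℂ] RKHS.OfKernel K) :=
    { toFun := fun s => Unitary.linearIsometryEquiv.symm (T s)
      map_one' := Subtype.ext <| hext _ _ fun x => by
        simp [hTv]
      map_mul' := fun s t => Subtype.ext <| hext _ _ fun x => by
        simp [hTv, mul_assoc] }
  have hρ : ∀ s x, (ρ s : RKHS.OfKernel K →L[ℂ] RKHS.OfKernel K) (v x) = v (s * x) := hTv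
  have hvc : Continuous v := by
    refine continuous_iff_continuousAt.2 fun x => tendsto_iff_norm_sub_tendsto_zero.2 ?_
    have e : ∀ y, ‖v y - v x‖ = √(φ (y⁻¹ * y) - φ (y⁻¹ * x) - φ (x⁻¹ * y) + φ (x⁻¹ * x)).re :=
      fun y => by
        rw [norm_eq_sqrt_re_inner (𝕜 := ℂ), inner_sub_left, inner_sub_right, inner_sub_right]
        simp only [hv]
        congr 1
        simp
        ring
    simp only [e]
    have : Continuous fun y =>
        √(φ (y⁻¹ * y) - φ (y⁻¹ * x) - φ (x⁻¹ * y) + φ (x⁻¹ * x)).re := by fun_prop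
    simpa using this.tendsto x
  refine ⟨RKHS.OfKernel K, inferInstance, inferInstance, inferInstance, ⟨ρ, fun w => ?_⟩, v 1,
    ?_, fun s => ?_⟩
  · have hw : w ∈ (Submodule.span ℂ (Set.range v)).topologicalClosure := hd ▸ Submodule.mem_top
    refine continuous_iff_continuousAt.2 fun s => Metric.tendsto_nhds.2 fun ε hε => ?_
    obtain ⟨u, hu, huw⟩ := Metric.mem_closure_iff.1 hw (ε / 3) (by positivity)
    have huc : Continuous fun s => (ρ s : RKHS.OfKernel K →L[ℂ] RKHS.OfKernel K) u := by
      clear huw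
      induction hu using Submodule.span_induction with
      | mem u hu =>
        obtain ⟨x, rfl⟩ := hu
        simp only [hρ]
        exact hvc.comp (continuous_mul_const x)
      | zero => simp [continuous_const]
      | add a b _ _ ha hb => simp only [map_add]; exact Continuous.add ha hb
      | smul c a _ ha => simp only [map_smul]; exact Continuous.const_smul ha c
    filter_upwards [Metric.tendsto_nhds.1 (huc.tendsto s) (ε / 3) (by positivity)] with t ht
    have hd' : ∀ r, dist ((ρ r : RKHS.OfKernel K →L[ℂ] RKHS.OfKernel K) w)
        ((ρ r : RKHS.OfKernel K →L[ℂ] RKHS.OfKernel K) u) = dist w u := fun r => by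
      rw [dist_eq_norm, ← map_sub, Unitary.norm_map, dist_eq_norm]
    calc _ ≤ dist ((ρ t : RKHS.OfKernel K →L[ℂ] RKHS.OfKernel K) w)
          ((ρ t : RKHS.OfKernel K →L[ℂ] RKHS.OfKernel K) u) +
          dist ((ρ t : RKHS.OfKernel K →L[ℂ] RKHS.OfKernel K) u)
          ((ρ s : RKHS.OfKernel K →L[ℂ] RKHS.OfKernel K) u) +
          dist ((ρ s : RKHS.OfKernel K →L[ℂ] RKHS.OfKernel K) u)
          ((ρ s : RKHS.OfKernel K →L[ℂ] RKHS.OfKernel K) w) := dist_triangle4 _ _ _ _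
      _ < ε := by
        rw [hd' t, dist_comm _ ((ρ s : RKHS.OfKernel K →L[ℂ] RKHS.OfKernel K) w), hd' s]
        linarith
  · have : (Set.range fun s => (ρ s : RKHS.OfKernel K →L[ℂ] RKHS.OfKernel K) (v 1)) = Set.range v := by
      congr 1; funext s; rw [hρ, mul_one]
    unfold UnitaryRep.IsCyclic UnitaryRep.op
    rw [this, hd]
  · change _ = ⟪v 1, (ρ s : RKHS.OfKernel K →L[ℂ] RKHS.OfKernel K) (v 1)⟫_ℂ
    rw [hρ, hv]; simp

end Existence

/-! ### Operators on `L²(G)` -/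

section Operators

variable {α : Type*} [MeasurableSpace α] (μ : Measure α)

/-- The Hilbert space `L²(α, μ)`. -/
abbrev L2 : Type _ := Lp ℂ 2 μ

variable {μ} in
/-- The multiplication operator `M_f` on `L²`, for `f ∈ L^∞`. -/
def mulOp (f : Lp ℂ ∞ μ) : L2 μ →L[ℂ] L2 μ :=
  (ContinuousLinearMap.mul ℂ ℂ).holderL μ ∞ 2 2 f

end Operators

section Hilbert

variable {K : Type*} [NormedAddCommGroup K] [InnerProductSpace ℂ K]

/-- `y = w*-∑ᵢ aᵢ` in `𝓑(K)`: the finite partial sums converge to `y` when tested against every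
normal functional `x ↦ tr(xρ) = ∑ₙ ⟨x fₙ, gₙ⟩`, where `∑ₙ ‖fₙ‖² < ∞` and `∑ₙ ‖gₙ‖² < ∞`
(these are exactly the functionals given by trace class operators `ρ`). -/
def HasWeakStarSum {ι : Type*} (a : ι → K →L[ℂ] K) (y : K →L[ℂ] K) : Prop :=
  ∀ f g : ℕ → K, Summable (fun n => ‖f n‖ ^ 2) → Summable (fun n => ‖g n‖ ^ 2) →
    HasSum (fun i => ∑' n, ⟪g n, a i (f n)⟫_ℂ) (∑' n, ⟪g n, y (f n)⟫_ℂ)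

/-- Weak* limits are unique. -/
lemma HasWeakStarSum.unique {ι : Type*} {a : ι → K →L[ℂ] K} {y z : K →L[ℂ] K}
    (hy : HasWeakStarSum a y) (hz : HasWeakStarSum a z) : y = z := by
  ext v
  refine ext_inner_left ℂ fun w => ?_
  have hs : ∀ u : K, Summable fun n : ℕ => ‖(if n = 0 then u else 0 : K)‖ ^ 2 := fun u =>
    summable_of_ne_finset_zero (s := {0}) fun n hn => by
      simp [show n ≠ 0 by simpa using hn]
  have key := (hy _ _ (hs v) (hs w)).unique (hz _ _ (hs v) (hs w))
  have e : ∀ t : K →L[ℂ] K, ∑' n : ℕ, ⟪(if n = 0 then w else 0 : K),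
      t (if n = 0 then v else 0)⟫_ℂ = ⟪w, t v⟫_ℂ := fun t => by
    rw [tsum_eq_single 0 fun n hn => by simp [hn]]
    simp
  rwa [e, e] at key

/-- A self-map of `𝓑(K)` is a unitary conjugation if it is `x ↦ U x U*` for a unitary `U`. -/
def IsUnitaryConjugation [CompleteSpace K] (Φ : (K →L[ℂ] K) → (K →L[ℂ] K)) : Prop :=
  ∃ U ∈ unitary (K →L[ℂ] K), ∀ x, Φ x = U ∘L x ∘L ContinuousLinearMap.adjoint U

/-- If `∑ᵢ ‖aᵢ* f‖² ≤ C ‖f‖²` then the series `∑ᵢ aᵢ x aᵢ*` converges weak*. -/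
lemma exists_hasWeakStarSum [CompleteSpace K] {ι : Type*} (a : ι → K →L[ℂ] K) (C : ℝ)
    (ha : ∀ (f : K) (F : Finset ι),
      ∑ i ∈ F, ‖ContinuousLinearMap.adjoint (a i) f‖ ^ 2 ≤ C * ‖f‖ ^ 2)
    (x : K →L[ℂ] K) :
    ∃ y, HasWeakStarSum (fun i => a i ∘L x ∘L ContinuousLinearMap.adjoint (a i)) y := by
  have hsum : ∀ f, Summable fun i => ‖ContinuousLinearMap.adjoint (a i) f‖ ^ 2 := fun f =>
    summable_of_sum_le (fun _ => sq_nonneg _) (ha f)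
  have htsum : ∀ f, ∑' i, ‖ContinuousLinearMap.adjoint (a i) f‖ ^ 2 ≤ C * ‖f‖ ^ 2 := fun f =>
    (hsum f).tsum_le_of_sum_le (ha f)
  -- pointwise bound of the terms
  have hb : ∀ (i : ι) (g f : K), ‖⟪g, (a i ∘L x ∘L ContinuousLinearMap.adjoint (a i)) f⟫_ℂ‖ ≤
      ‖x‖ * (‖ContinuousLinearMap.adjoint (a i) g‖ ^ 2
        + ‖ContinuousLinearMap.adjoint (a i) f‖ ^ 2) := fun i g f => by
    have h1 : ⟪g, (a i ∘L x ∘L ContinuousLinearMap.adjoint (a i)) f⟫_ℂ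
        = ⟪ContinuousLinearMap.adjoint (a i) g, x (ContinuousLinearMap.adjoint (a i) f)⟫_ℂ := by
      rw [ContinuousLinearMap.adjoint_inner_left]; rfl
    rw [h1]
    set p := ContinuousLinearMap.adjoint (a i) g
    set q := ContinuousLinearMap.adjoint (a i) f
    calc ‖⟪p, x q⟫_ℂ‖ ≤ ‖p‖ * ‖x q‖ := norm_inner_le_norm _ _
      _ ≤ ‖p‖ * (‖x‖ * ‖q‖) := by gcongr; exact x.le_opNorm q
      _ = ‖x‖ * (‖p‖ * ‖q‖) := by ring
      _ ≤ ‖x‖ * (‖p‖ ^ 2 + ‖q‖ ^ 2) := by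
        gcongr; nlinarith [sq_nonneg (‖p‖ - ‖q‖), sq_nonneg (‖p‖ + ‖q‖)]
  have hS : ∀ g f : K, Summable fun i =>
      ⟪g, (a i ∘L x ∘L ContinuousLinearMap.adjoint (a i)) f⟫_ℂ := fun g f =>
    Summable.of_norm_bounded (((hsum g).add (hsum f)).mul_left ‖x‖) fun i => hb i g f
  -- the sesquilinear form
  let B : K →ₗ⋆[ℂ] K →ₗ[ℂ] ℂ := LinearMap.mk₂'ₛₗ _ _
    (fun g f => ∑' i, ⟪g, (a i ∘L x ∘L ContinuousLinearMap.adjoint (a i)) f⟫_ℂ)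
    (fun g g' f => by
      rw [← (hS g f).tsum_add (hS g' f)]; exact tsum_congr fun i => inner_add_left _ _ _)
    (fun c g f => by
      rw [smul_eq_mul, ← tsum_mul_left]; exact tsum_congr fun i => inner_smul_left _ _ _)
    (fun g f f' => by
      rw [← (hS g f).tsum_add (hS g f')]
      exact tsum_congr fun i => by rw [map_add, inner_add_right])
    (fun c g f => by
      rw [smul_eq_mul, ← tsum_mul_left]
      exact tsum_congr fun i => by rw [map_smul, inner_smul_right]; rfl)
  have hB0 : ∀ g f : K, ‖B g f‖ ≤ ‖x‖ * C * (‖g‖ ^ 2 + ‖f‖ ^ 2) := fun g f => by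
    have h2 := ((hsum g).add (hsum f)).mul_left ‖x‖
    calc ‖B g f‖ ≤ ∑' i, ‖x‖ * (‖ContinuousLinearMap.adjoint (a i) g‖ ^ 2
        + ‖ContinuousLinearMap.adjoint (a i) f‖ ^ 2) :=
          tsum_of_norm_bounded h2.hasSum fun i => hb i g f
      _ = ‖x‖ * (∑' i, ‖ContinuousLinearMap.adjoint (a i) g‖ ^ 2
        + ∑' i, ‖ContinuousLinearMap.adjoint (a i) f‖ ^ 2) := by
          rw [tsum_mul_left, (hsum g).tsum_add (hsum f)]
      _ ≤ ‖x‖ * (C * ‖g‖ ^ 2 + C * ‖f‖ ^ 2) := by gcongr <;> exact htsum _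
      _ = _ := by ring
  have hB : ∀ g f : K, ‖B g f‖ ≤ 2 * (‖x‖ * C) * ‖g‖ * ‖f‖ := fun g f => by
    by_cases hg : g = 0
    · simp [hg]
    by_cases hf : f = 0
    · simp [hf]
    have hg' : ‖g‖ ≠ 0 := norm_ne_zero_iff.2 hg
    have hf' : ‖f‖ ≠ 0 := norm_ne_zero_iff.2 hf
    have h3 := hB0 (((‖g‖⁻¹ : ℝ) : ℂ) • g) (((‖f‖⁻¹ : ℝ) : ℂ) • f)
    have e1 : ∀ u : K, ‖u‖ ≠ 0 → ‖((‖u‖⁻¹ : ℝ) : ℂ) • u‖ = 1 := fun u hu => by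
      rw [norm_smul, Complex.norm_real, norm_inv, norm_norm, inv_mul_cancel₀ hu]
    rw [e1 g hg', e1 f hf', LinearMap.map_smulₛₗ₂, map_smul, norm_smul, norm_smul] at h3
    simp only [RCLike.norm_conj, Complex.norm_real, norm_inv, norm_norm] at h3
    have h4 : ‖B g f‖ = ‖g‖ * ‖f‖ * (‖g‖⁻¹ * (‖f‖⁻¹ * ‖B g f‖)) := by field_simp
    rw [h4]
    calc _ ≤ ‖g‖ * ‖f‖ * (‖x‖ * C * (1 ^ 2 + 1 ^ 2)) := by gcongr
      _ = _ := by ring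
  let y : K →L[ℂ] K := ContinuousLinearMap.adjoint
    (InnerProductSpace.continuousLinearMapOfBilin (B.mkContinuous₂ _ hB))
  have hy : ∀ g f : K, HasSum (fun i =>
      ⟪g, (a i ∘L x ∘L ContinuousLinearMap.adjoint (a i)) f⟫_ℂ) ⟪g, y f⟫_ℂ := fun g f => by
    have : ⟪g, y f⟫_ℂ = ∑' i, ⟪g, (a i ∘L x ∘L ContinuousLinearMap.adjoint (a i)) f⟫_ℂ := by
      simp only [y]
      rw [ContinuousLinearMap.adjoint_inner_right,
        InnerProductSpace.continuousLinearMapOfBilin_apply]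
      rfl
    rw [this]
    exact (hS g f).hasSum
  refine ⟨y, fun f g hf hg => ?_⟩
  have hP : Summable fun p : ℕ × ι =>
      ⟪g p.1, (a p.2 ∘L x ∘L ContinuousLinearMap.adjoint (a p.2)) (f p.1)⟫_ℂ := by
    refine Summable.of_norm_bounded (g := fun p : ℕ × ι =>
      ‖x‖ * (‖ContinuousLinearMap.adjoint (a p.2) (g p.1)‖ ^ 2
        + ‖ContinuousLinearMap.adjoint (a p.2) (f p.1)‖ ^ 2)) ?_ fun p => hb _ _ _
    have hQ : ∀ u : ℕ → K, Summable (fun n => ‖u n‖ ^ 2) →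
        Summable fun p : ℕ × ι => ‖ContinuousLinearMap.adjoint (a p.2) (u p.1)‖ ^ 2 :=
      fun u hu => (summable_prod_of_nonneg fun _ => sq_nonneg _).2
        ⟨fun n => hsum (u n), Summable.of_nonneg_of_le (fun n => tsum_nonneg fun _ => sq_nonneg _)
          (fun n => htsum (u n)) (hu.mul_left C)⟩
    exact ((hQ g hg).add (hQ f hf)).mul_left _
  have e : ∑' n, ⟪g n, y (f n)⟫_ℂ = ∑' p : ℕ × ι,
      ⟪g p.1, (a p.2 ∘L x ∘L ContinuousLinearMap.adjoint (a p.2)) (f p.1)⟫_ℂ := by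
    rw [hP.tsum_prod]
    exact tsum_congr fun n => (hy (g n) (f n)).tsum_eq.symm
  rw [e]
  have hP' := (Equiv.prodComm ι ℕ).summable_iff.2 hP
  have h5 := ((Equiv.prodComm ι ℕ).hasSum_iff.2 hP.hasSum)
  exact h5.prod_fiberwise fun i => (hP'.prod_factor i).hasSum

end Hilbert

/-! ### The channel `Θ̂(φ)` -/

section Channel

variable {G : Type*} [Group G] [TopologicalSpace G] [MeasurableSpace G] [BorelSpace G]
variable {H : Type*} [NormedAddCommGroup H] [InnerProductSpace ℂ H] [CompleteSpace H]
variable {ι : Type*}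

/-- The coefficient function `ξᵢ(s) = ⟨eᵢ, π(s)* ξ⟩` (linear in `eᵢ`). -/
def coeff (π : UnitaryRep G H) (ξ : H) (e : HilbertBasis ι ℂ H) (i : ι) (s : G) : ℂ :=
  ⟪ContinuousLinearMap.adjoint (π.op s) ξ, e i⟫_ℂ

lemma memLp_coeff (μ : Measure G) (π : UnitaryRep G H) (ξ : H) (e : HilbertBasis ι ℂ H) (i : ι) :
    MemLp (coeff π ξ e i) ∞ μ := by
  have hc : Continuous (coeff π ξ e i) := by
    have h : coeff π ξ e i = fun s => ⟪ξ, π.op s (e i)⟫_ℂ := by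
      funext s; exact ContinuousLinearMap.adjoint_inner_left _ _ _
    rw [h]
    exact continuous_const.inner (π.continuous_apply (e i))
  refine memLp_top_of_bound hc.aestronglyMeasurable (‖ξ‖ * ‖e i‖) (.of_forall fun s => ?_)
  calc ‖coeff π ξ e i s‖ ≤ ‖ContinuousLinearMap.adjoint (π.op s) ξ‖ * ‖e i‖ :=
        norm_inner_le_norm _ _
    _ = ‖ξ‖ * ‖e i‖ := by rw [π.adjoint_op, π.norm_op_apply]

/-- The Kraus operator `M_{ξᵢ}` on `L²(G)`. -/
def kraus (μ : Measure G) (π : UnitaryRep G H) (ξ : H) (e : HilbertBasis ι ℂ H) (i : ι) :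
    L2 μ →L[ℂ] L2 μ :=
  mulOp (memLp_coeff μ π ξ e i).toLp

lemma adjoint_kraus_apply (μ : Measure G) (π : UnitaryRep G H) (ξ : H) (e : HilbertBasis ι ℂ H)
    (i : ι) (f : L2 μ) : ContinuousLinearMap.adjoint (kraus μ π ξ e i) f =ᵐ[μ]
      fun s => conj (coeff π ξ e i s) * f s := by
  have hm : MemLp (fun s => conj (coeff π ξ e i s)) ∞ μ := (memLp_coeff μ π ξ e i).star
  have hk : ContinuousLinearMap.adjoint (kraus μ π ξ e i) f = mulOp hm.toLp f := by
    refine ext_inner_right ℂ fun g => ?_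
    rw [ContinuousLinearMap.adjoint_inner_left, L2.inner_def, L2.inner_def]
    refine integral_congr_ae ?_
    filter_upwards [(ContinuousLinearMap.mul ℂ ℂ).coeFn_holder (r := 2) hm.toLp f,
      (ContinuousLinearMap.mul ℂ ℂ).coeFn_holder (r := 2) (memLp_coeff μ π ξ e i).toLp g,
      hm.coeFn_toLp, (memLp_coeff μ π ξ e i).coeFn_toLp] with s h1 h2 h3 h4
    simp only [kraus, mulOp, ContinuousLinearMap.holderL_apply_apply, h1, h2, h3, h4,
      ContinuousLinearMap.mul_apply', RCLike.inner_apply, map_mul, RCLike.conj_conj]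
    ring
  rw [hk]
  filter_upwards [(ContinuousLinearMap.mul ℂ ℂ).coeFn_holder (r := 2) hm.toLp f,
    hm.coeFn_toLp] with s h1 h3
  simp only [mulOp, ContinuousLinearMap.holderL_apply_apply, h1, h3,
    ContinuousLinearMap.mul_apply']

lemma sum_adjoint_kraus_le (μ : Measure G) (π : UnitaryRep G H) (ξ : H) (e : HilbertBasis ι ℂ H)
    (f : L2 μ) (F : Finset ι) :
    ∑ i ∈ F, ‖ContinuousLinearMap.adjoint (kraus μ π ξ e i) f‖ ^ 2 ≤ ‖ξ‖ ^ 2 * ‖f‖ ^ 2 := by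
  have hn : ∀ h : L2 μ, ‖h‖ ^ 2 = ∫ s, ‖h s‖ ^ 2 ∂μ := fun h => by
    have := congrArg Complex.re (L2.inner_def (𝕜 := ℂ) h h)
    rw [inner_self_eq_norm_sq_to_K] at this
    simp only [inner_self_eq_norm_sq_to_K, Complex.coe_algebraMap] at this
    norm_cast at this
  have hi : ∀ h : L2 μ, Integrable (fun s => ‖h s‖ ^ 2) μ := fun h =>
    (Lp.memLp h).integrable_norm_pow (by norm_num)
  calc ∑ i ∈ F, ‖ContinuousLinearMap.adjoint (kraus μ π ξ e i) f‖ ^ 2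
      = ∫ s, ∑ i ∈ F, ‖ContinuousLinearMap.adjoint (kraus μ π ξ e i) f s‖ ^ 2 ∂μ := by
        rw [integral_finsetSum _ fun i _ => hi _]
        exact Finset.sum_congr rfl fun i _ => hn _
    _ ≤ ∫ s, ‖ξ‖ ^ 2 * ‖f s‖ ^ 2 ∂μ := by
        refine integral_mono_ae (integrable_finsetSum _ fun i _ => hi _) ((hi f).const_mul _) ?_
        have hall : ∀ᵐ s ∂μ, ∀ i ∈ F, ContinuousLinearMap.adjoint (kraus μ π ξ e i) f s
            = conj (coeff π ξ e i s) * f s :=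
          (Filter.eventually_all_finset F).2 fun i _ => adjoint_kraus_apply μ π ξ e i f
        filter_upwards [hall] with s hs
        calc ∑ i ∈ F, ‖ContinuousLinearMap.adjoint (kraus μ π ξ e i) f s‖ ^ 2
            = (∑ i ∈ F, ‖⟪e i, ContinuousLinearMap.adjoint (π.op s) ξ⟫_ℂ‖ ^ 2) * ‖f s‖ ^ 2 := by
              rw [Finset.sum_mul]
              refine Finset.sum_congr rfl fun i hiF => ?_
              rw [hs i hiF, norm_mul, RCLike.norm_conj, mul_pow, coeff, norm_inner_symm]
          _ ≤ ‖ContinuousLinearMap.adjoint (π.op s) ξ‖ ^ 2 * ‖f s‖ ^ 2 := by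
              gcongr; exact e.orthonormal.sum_inner_products_le _
          _ = ‖ξ‖ ^ 2 * ‖f s‖ ^ 2 := by rw [π.adjoint_op, π.norm_op_apply]
    _ = ‖ξ‖ ^ 2 * ‖f‖ ^ 2 := by rw [integral_const_mul, hn f]

lemma exists_channel (μ : Measure G) (π : UnitaryRep G H) (ξ : H) (e : HilbertBasis ι ℂ H)
    (x : L2 μ →L[ℂ] L2 μ) :
    ∃ y, HasWeakStarSum (fun i => kraus μ π ξ e i ∘L x ∘L
      ContinuousLinearMap.adjoint (kraus μ π ξ e i)) y :=
  exists_hasWeakStarSum _ (‖ξ‖ ^ 2) (sum_adjoint_kraus_le μ π ξ e) x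

/-- The map `Θ̂(φ)(x) = w*-∑ᵢ M_{ξᵢ} x M_{ξᵢ}*` on `𝓑(L²(G))`, for `φ = (π, ξ)` and an orthonormal
basis `(eᵢ)` of the representation space. -/
def thetaHat (μ : Measure G) (π : UnitaryRep G H) (ξ : H) (e : HilbertBasis ι ℂ H)
    (x : L2 μ →L[ℂ] L2 μ) : L2 μ →L[ℂ] L2 μ :=
  (exists_channel μ π ξ e x).choose

/-- The defining property of `Θ̂(φ)`; it determines `Θ̂(φ)(x)` by `HasWeakStarSum.unique`. -/
theorem thetaHat_spec (μ : Measure G) (π : UnitaryRep G H) (ξ : H) (e : HilbertBasis ι ℂ H)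
    (x : L2 μ →L[ℂ] L2 μ) :
    HasWeakStarSum (fun i => kraus μ π ξ e i ∘L x ∘L
      ContinuousLinearMap.adjoint (kraus μ π ξ e i)) (thetaHat μ π ξ e x) :=
  (exists_channel μ π ξ e x).choose_spec

end Channel

end DualChannel

end

/-!
Write `k i` for the multiplication operator by `ξᵢ(s) = ⟨eᵢ, π(s)* ξ⟩`, where
`⟨·, ·⟩` is linear in the first variable, that is, `⟨x, y⟩ = ⟪y, x⟫_ℂ`. Both directions pass through
the condition that `ξ` is a joint eigenvector, `π(s) ξ = φ(s) ξ` for all `s`.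

If the channel is `x ↦ U x U*`, it maps the rank one operator `|f⟩⟨f|` to `|U f⟩⟨U f|`. Since this is
also the sum of the positive operators `|k i f⟩⟨k i f|`, every `k i f = ξᵢ f` lies on the line
through `U f` (`HasWeakStarSum.mem_span_of_rankOne`). Taking for `f` the indicator function of an
open set of finite measure that contains `1` and `s`, and using that the `ξᵢ` are continuous, the
functions `ξᵢ` are pairwise proportional on that set (`coeff_mul_coeff_comm`). So the vectors
`π(s)* ξ` and `ξ` have proportional coordinates, `π(s) ξ = φ(s) ξ`, and `φ` is multiplicative
(`UnitaryRep.Represents.isCharacter`).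

If `φ` is a character `χ`, equality in the Cauchy–Schwarz inequality gives `π(s) ξ = χ(s) ξ`, whence
`k i = ⟨eᵢ, ξ⟩ M_χ`. By Parseval's identity `∑ᵢ |⟨eᵢ, ξ⟩|² = 1`, so the channel is conjugation by the
unitary `M_χ` (`thetaHat_eq_conj`).
-/

open MeasureTheory
open scoped ENNReal ComplexConjugate InnerProductSpace

namespace DualChannel

/-! ### Weak* sums -/

section Hilbert

variable {K : Type*} [NormedAddCommGroup K] [InnerProductSpace ℂ K] {ι : Type*}

lemma HasWeakStarSum.hasSum_inner {a : ι → K →L[ℂ] K} {y : K →L[ℂ] K}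
    (h : HasWeakStarSum a y) (v w : K) : HasSum (fun i => ⟪w, a i v⟫_ℂ) ⟪w, y v⟫_ℂ := by
  have hs : ∀ u : K, Summable fun n : ℕ => ‖(if n = 0 then u else 0 : K)‖ ^ 2 := fun u =>
    summable_of_ne_finset_zero (s := {0}) fun n hn => by
      simp [show n ≠ 0 by simpa using hn]
  have e : ∀ t : K →L[ℂ] K, ∑' n : ℕ, ⟪(if n = 0 then w else 0 : K),
      t (if n = 0 then v else 0)⟫_ℂ = ⟪w, t v⟫_ℂ := fun t => by
    rw [tsum_eq_single 0 fun n hn => by simp [hn]]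
    simp
  simpa only [e] using h _ _ (hs v) (hs w)

lemma hasWeakStarSum_smul {w : ι → ℂ} {c : ℂ} (h : HasSum w c) (y : K →L[ℂ] K) :
    HasWeakStarSum (fun i => w i • y) (c • y) := fun f g _ _ => by
  simp only [smul_apply, inner_smul_right, tsum_mul_left]
  exact h.mul_right _

variable [CompleteSpace K]

lemma inner_conj_rankOne (a : K →L[ℂ] K) (f v : K) :
    ⟪v, (a ∘L InnerProductSpace.rankOne ℂ f f ∘L ContinuousLinearMap.adjoint a) v⟫_ℂ =
      ((‖⟪v, a f⟫_ℂ‖ ^ 2 : ℝ) : ℂ) := by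
  simp only [ContinuousLinearMap.comp_apply, InnerProductSpace.rankOne_apply, map_smul,
    inner_smul_right, ContinuousLinearMap.adjoint_inner_right]
  rw [← inner_conj_symm, Complex.conj_mul']
  norm_cast

/-- If the rank one operator `|U f⟩⟨U f|` is the weak* sum of the operators `|aᵢ f⟩⟨aᵢ f|`, then
every `aᵢ f` lies on the line through `U f`: it is orthogonal to every vector orthogonal to `U f`. -/
lemma HasWeakStarSum.mem_span_of_rankOne {a : ι → K →L[ℂ] K} {U : K →L[ℂ] K} {f : K}
    (h : HasWeakStarSum
      (fun i => a i ∘L InnerProductSpace.rankOne ℂ f f ∘L ContinuousLinearMap.adjoint (a i))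
      (U ∘L InnerProductSpace.rankOne ℂ f f ∘L ContinuousLinearMap.adjoint U)) (i : ι) :
    a i f ∈ Submodule.span ℂ {U f} := by
  rw [← Submodule.orthogonal_orthogonal (Submodule.span ℂ {U f}), Submodule.mem_orthogonal]
  intro v hv
  have hU : ⟪v, U f⟫_ℂ = 0 := Submodule.mem_orthogonal_singleton_iff_inner_left.1 hv
  have hs := h.hasSum_inner v v
  simp only [inner_conj_rankOne, hU] at hs
  have hs' := (hasSum_zero_iff_of_nonneg fun i => sq_nonneg _).1
    ((Complex.hasSum_ofReal (f := fun i => ‖⟪v, a i f⟫_ℂ‖ ^ 2) (x := 0)).1 (by simpa using hs))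
  simpa using congrFun hs' i

end Hilbert

/-! ### Multiplication operators -/

section MulOp

variable {α : Type*} [MeasurableSpace α] {μ : Measure α}

lemma mulOp_toLp_apply {f : α → ℂ} (hf : MemLp f ∞ μ) (g : L2 μ) :
    mulOp hf.toLp g =ᵐ[μ] fun s => f s * g s := by
  filter_upwards [(ContinuousLinearMap.mul ℂ ℂ).coeFn_holder (r := 2) hf.toLp g,
    hf.coeFn_toLp] with s h1 h2
  simp only [mulOp, ContinuousLinearMap.holderL_apply_apply, h1, h2,
    ContinuousLinearMap.mul_apply']

lemma adjoint_mulOp_toLp {f : α → ℂ} (hf : MemLp f ∞ μ) :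
    ContinuousLinearMap.adjoint (mulOp hf.toLp) =
      mulOp (MemLp.toLp (fun s => conj (f s)) hf.star) := by
  refine ((ContinuousLinearMap.eq_adjoint_iff _ _).2 fun g h => ?_).symm
  rw [L2.inner_def, L2.inner_def]
  refine integral_congr_ae ?_
  filter_upwards [mulOp_toLp_apply hf h, mulOp_toLp_apply (f := fun s => conj (f s)) hf.star g]
    with s h1 h2
  simp only [h1, h2, RCLike.inner_apply, map_mul, RCLike.conj_conj]
  ring

lemma mulOp_toLp_comp_mulOp_toLp {f g : α → ℂ} (hf : MemLp f ∞ μ) (hg : MemLp g ∞ μ)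
    (hfg : ∀ s, f s * g s = 1) : mulOp hf.toLp * mulOp hg.toLp = 1 := by
  ext1 h
  refine Lp.ext ?_
  filter_upwards [mulOp_toLp_apply hf (mulOp hg.toLp h), mulOp_toLp_apply hg h] with s h1 h2
  rw [mul_apply_eq_comp, h1, h2, ← mul_assoc, hfg, one_mul,
    one_apply_eq_self]

lemma mulOp_toLp_mem_unitary {f : α → ℂ} (hf : MemLp f ∞ μ) (h1 : ∀ s, ‖f s‖ = 1) :
    mulOp hf.toLp ∈ unitary (L2 μ →L[ℂ] L2 μ) := by
  rw [Unitary.mem_iff, ContinuousLinearMap.star_eq_adjoint, adjoint_mulOp_toLp]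
  exact ⟨mulOp_toLp_comp_mulOp_toLp _ _ fun s => by simp [Complex.conj_mul', h1],
    mulOp_toLp_comp_mulOp_toLp _ _ fun s => by simp [Complex.mul_conj', h1]⟩

end MulOp

/-! ### Joint eigenvectors and characters -/

section Representation

variable {G : Type*} [Group G] [TopologicalSpace G]
variable {H : Type*} [NormedAddCommGroup H] [InnerProductSpace ℂ H] [CompleteSpace H]

namespace UnitaryRep

variable {π : UnitaryRep G H} {ξ : H} {φ : G → ℂ}

lemma op_one (π : UnitaryRep G H) (v : H) : π.op 1 v = v := by
  simp [op]

lemma op_mul (π : UnitaryRep G H) (s t : G) (v : H) : π.op (s * t) v = π.op s (π.op t v) := by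
  simp [op]

/-- The supremum of `|φ(s)| = |⟨π(s) ξ, ξ⟩|` is attained at `s = 1`, with value `‖ξ‖²`. -/
lemma Represents.norm_eq_one (hπ : π.Represents ξ φ) (hφ : φ ∈ P₁ G) : ‖ξ‖ = 1 := by
  have hb : ∀ s, ‖φ s‖ ≤ ‖ξ‖ ^ 2 := fun s => by
    rw [hπ.2 s]
    refine (norm_inner_le_norm _ _).trans_eq ?_
    rw [π.norm_op_apply, sq]
  have h1 : ‖φ 1‖ = ‖ξ‖ ^ 2 := by
    rw [hπ.2 1, op_one, inner_self_eq_norm_sq_to_K]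
    simp
  have h2 : ⨆ s, ‖φ s‖ = ‖ξ‖ ^ 2 :=
    le_antisymm (ciSup_le hb) (h1 ▸ le_ciSup (f := fun s => ‖φ s‖)
      ⟨_, Set.forall_mem_range.2 hb⟩ 1)
  exact (pow_eq_one_iff_of_nonneg (norm_nonneg ξ) two_ne_zero).1 (h2 ▸ hφ.2.2)

/-- Equality in the Cauchy–Schwarz inequality `|⟨π(s) ξ, ξ⟩| ≤ ‖ξ‖²`. -/
lemma Represents.op_apply_of_norm_eq_one (hπ : π.Represents ξ φ) (hξ : ‖ξ‖ = 1) {s : G}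
    (hs : ‖φ s‖ = 1) : π.op s ξ = φ s • ξ := by
  refine ((inner_eq_one_iff_of_norm_eq_one (𝕜 := ℂ) ?_ ?_).1 ?_).symm
  · rw [norm_smul, hs, hξ, one_mul]
  · rw [π.norm_op_apply, hξ]
  · rw [inner_smul_left, ← hπ.2, Complex.conj_mul', hs]
    simp

lemma Represents.isCharacter (hπ : π.Represents ξ φ) (hφ : φ ∈ P₁ G)
    (h : ∀ s, π.op s ξ = φ s • ξ) : IsCharacter φ := by
  have hξ := hπ.norm_eq_one hφ
  have hξ0 : ξ ≠ 0 := norm_ne_zero_iff.1 (hξ.trans_ne one_ne_zero)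
  have h1 : ∀ s, ‖φ s‖ = 1 := fun s => by
    have := congrArg norm (h s)
    rwa [π.norm_op_apply, norm_smul, hξ, mul_one, eq_comm] at this
  let χ : G →* Circle := MonoidHom.mk' (fun s => ⟨φ s, mem_sphere_zero_iff_norm.2 (h1 s)⟩)
    fun s t => Subtype.ext <| smul_left_injective ℂ hξ0 <| by
      change φ (s * t) • ξ = (φ s * φ t) • ξ
      rw [← h, op_mul, h t, map_smul, h s, smul_smul, mul_comm]
  exact ⟨⟨χ, hφ.1.subtype_mk _⟩, fun s => rfl⟩

end UnitaryRep

end Representation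

/-! ### The channel -/

section Channel

variable {G : Type*} [Group G] [TopologicalSpace G]
variable {H : Type*} [NormedAddCommGroup H] [InnerProductSpace ℂ H] [CompleteSpace H]
variable {ι : Type*}

lemma continuous_coeff (π : UnitaryRep G H) (ξ : H) (e : HilbertBasis ι ℂ H) (i : ι) :
    Continuous (coeff π ξ e i) := by
  have h : coeff π ξ e i = fun s => ⟪ξ, π.op s (e i)⟫_ℂ := by
    funext s; exact ContinuousLinearMap.adjoint_inner_left _ _ _
  rw [h]
  exact continuous_const.inner (π.continuous_apply (e i))

lemma coeff_one (π : UnitaryRep G H) (ξ : H) (e : HilbertBasis ι ℂ H) (i : ι) :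
    coeff π ξ e i 1 = ⟪ξ, e i⟫_ℂ := by
  rw [coeff, π.adjoint_op, inv_one, π.op_one]

/-- A unit vector `ξ` whose coordinates are proportional to those of every `π(s)* ξ` is a joint
eigenvector. -/
lemma op_apply_of_coeff_mul_coeff_comm {φ : G → ℂ} {π : UnitaryRep G H} {ξ : H}
    (hπ : π.Represents ξ φ) (hξ : ‖ξ‖ = 1) (e : HilbertBasis ι ℂ H)
    (h : ∀ i j s, coeff π ξ e i s * coeff π ξ e j 1 = coeff π ξ e j s * coeff π ξ e i 1) (s : G) :
    π.op s ξ = φ s • ξ := by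
  have hparseval : ∀ u v : H, HasSum (fun i => ⟪u, e i⟫_ℂ * ⟪e i, v⟫_ℂ) ⟪u, v⟫_ℂ :=
    e.hasSum_inner_mul_inner
  have hξξ : ⟪ξ, ξ⟫_ℂ = 1 := by rw [inner_self_eq_norm_sq_to_K, hξ]; simp
  refine e.repr.injective ?_
  ext j
  rw [HilbertBasis.repr_apply_apply, HilbertBasis.repr_apply_apply, inner_smul_right, hπ.2]
  -- The relation for `s⁻¹`, multiplied by `⟪e i, ξ⟫_ℂ` and summed over `i` by Parseval's identity.
  have hij : ∀ i, ⟪π.op s ξ, e i⟫_ℂ * ⟪ξ, e j⟫_ℂ = ⟪π.op s ξ, e j⟫_ℂ * ⟪ξ, e i⟫_ℂ := fun i => by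
    have := h i j s⁻¹
    rwa [coeff_one, coeff_one, coeff, coeff, π.adjoint_op, inv_inv] at this
  have h1 := (hparseval (π.op s ξ) ξ).mul_right ⟪ξ, e j⟫_ℂ
  have h2 := (hparseval ξ ξ).mul_left ⟪π.op s ξ, e j⟫_ℂ
  have h3 := h1.unique (h2.congr_fun fun i => by
    rw [mul_right_comm, hij, mul_assoc])
  rw [hξξ, mul_one] at h3
  have := congrArg conj h3
  rw [map_mul, inner_conj_symm, inner_conj_symm, inner_conj_symm] at this
  exact this.symm

variable [MeasurableSpace G] [BorelSpace G]

/-- The functions `ξᵢ` are pairwise proportional if all `M_{ξᵢ} f` lie on one line. -/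
lemma coeff_mul_coeff_comm [LocallyCompactSpace G] (μ : Measure G) [μ.IsOpenPosMeasure]
    [IsFiniteMeasureOnCompacts μ] {π : UnitaryRep G H} {ξ : H} {e : HilbertBasis ι ℂ H}
    (h : ∀ f : L2 μ, ∃ g : L2 μ, ∀ i, kraus μ π ξ e i f ∈ Submodule.span ℂ {g})
    (i j : ι) (s t : G) :
    coeff π ξ e i s * coeff π ξ e j t = coeff π ξ e j s * coeff π ξ e i t := by
  obtain ⟨C, hC, hsC⟩ := exists_compact_superset (Set.toFinite {s, t}).isCompact
  set V := interior C
  have hV : IsOpen V := isOpen_interior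
  have hμV : μ V ≠ ∞ := ((measure_mono interior_subset).trans_lt hC.measure_lt_top).ne
  obtain ⟨g, hg⟩ := h (indicatorConstLp 2 hV.measurableSet hμV 1)
  choose c hc using fun i => Submodule.mem_span_singleton.1 (hg i)
  have hk : ∀ i, ∀ᵐ r ∂μ, r ∈ V → coeff π ξ e i r = c i * g r := fun i => by
    have h1 := mulOp_toLp_apply (memLp_coeff μ π ξ e i)
      (indicatorConstLp 2 hV.measurableSet hμV 1)
    rw [← kraus, ← hc i] at h1
    filter_upwards [h1, Lp.coeFn_smul (c i) g,
      indicatorConstLp_coeFn (p := 2) (hs := hV.measurableSet) (hμs := hμV) (c := (1 : ℂ))]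
      with r h1 h2 h3 hr
    rw [h2, h3, Set.indicator_of_mem hr, mul_one] at h1
    exact h1.symm
  -- Used twice: at `t` with `(a, b) = (c i, c j)`, then at `s` with the values of `ξᵢ`, `ξⱼ` at `t`.
  have hae : ∀ i j (a b : ℂ), c j * a = c i * b →
      Set.EqOn (fun r => coeff π ξ e i r * b) (fun r => coeff π ξ e j r * a) V := by
    intro i j a b hab
    refine Measure.eqOn_open_of_ae_eq (μ := μ) ?_ hV
      ((continuous_coeff π ξ e i).mul_const _).continuousOn
      ((continuous_coeff π ξ e j).mul_const _).continuousOn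
    rw [Filter.EventuallyEq, ae_restrict_iff' hV.measurableSet]
    filter_upwards [hk i, hk j] with r h1 h2 hr
    rw [h1 hr, h2 hr]
    linear_combination -g r * hab
  have ht : c i * coeff π ξ e j t = c j * coeff π ξ e i t := by
    have := hae i j (c i) (c j) (mul_comm _ _) (hsC (by simp : t ∈ _))
    linear_combination -this
  exact hae i j _ _ ht.symm (hsC (by simp))

/-- If `ξ` is a joint eigenvector with eigencharacter `φ`, then `M_{ξᵢ} = ⟪ξ, eᵢ⟫ M_φ`. -/
lemma kraus_eq_smul (μ : Measure G) {φ : G → ℂ} {π : UnitaryRep G H} {ξ : H}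
    (h : ∀ s, π.op s ξ = φ s • ξ) (hinv : ∀ s, φ s⁻¹ = conj (φ s)) (hφ : MemLp φ ∞ μ)
    (e : HilbertBasis ι ℂ H) (i : ι) : kraus μ π ξ e i = ⟪ξ, e i⟫_ℂ • mulOp hφ.toLp := by
  have hc : coeff π ξ e i = ⟪ξ, e i⟫_ℂ • φ := by
    funext s
    rw [coeff, π.adjoint_op, h, inner_smul_left, hinv, Complex.conj_conj, mul_comm]
    rfl
  have ht : (memLp_coeff μ π ξ e i).toLp = ⟪ξ, e i⟫_ℂ • hφ.toLp := by
    rw [← MemLp.toLp_const_smul]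
    exact MemLp.toLp_congr _ _ (by rw [hc])
  rw [kraus, ht, mulOp, mulOp, map_smul]

lemma thetaHat_eq_conj (μ : Measure G) {π : UnitaryRep G H} {ξ : H} (hξ : ‖ξ‖ = 1)
    {e : HilbertBasis ι ℂ H} {U : L2 μ →L[ℂ] L2 μ}
    (h : ∀ i, kraus μ π ξ e i = ⟪ξ, e i⟫_ℂ • U) (x : L2 μ →L[ℂ] L2 μ) :
    thetaHat μ π ξ e x = U ∘L x ∘L ContinuousLinearMap.adjoint U := by
  have hsum : HasSum (fun i => ⟪ξ, e i⟫_ℂ * ⟪e i, ξ⟫_ℂ) 1 := by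
    have := e.hasSum_inner_mul_inner ξ ξ
    rwa [inner_self_eq_norm_sq_to_K, hξ, RCLike.ofReal_one, one_pow] at this
  have hw := hasWeakStarSum_smul hsum (U ∘L x ∘L ContinuousLinearMap.adjoint U)
  rw [one_smul] at hw
  refine (thetaHat_spec μ π ξ e x).unique ?_
  convert hw using 2 with i
  rw [h, map_smulₛₗ, ContinuousLinearMap.smul_comp, ContinuousLinearMap.comp_smul,
    ContinuousLinearMap.comp_smul, smul_smul, inner_conj_symm]

end Channel

end DualChannel

open DualChannel in
theorem mainTheorem9 {G : Type*} [Group G] [TopologicalSpace G] [IsTopologicalGroup G]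
    [LocallyCompactSpace G] [MeasurableSpace G] [BorelSpace G]
    (μ : Measure G) [μ.IsHaarMeasure] [μ.Regular]
    (φ : G → ℂ) (hφ : φ ∈ DualChannel.P₁ G)
    {H : Type*} [NormedAddCommGroup H] [InnerProductSpace ℂ H] [CompleteSpace H]
    (π : DualChannel.UnitaryRep G H) (ξ : H) (hπ : π.Represents ξ φ)
    {ι : Type*} (e : HilbertBasis ι ℂ H) :
    DualChannel.IsUnitaryConjugation (DualChannel.thetaHat μ π ξ e) ↔
      DualChannel.IsCharacter φ := by
  have hξ := hπ.norm_eq_one hφ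
  constructor
  · rintro ⟨U, -, hU⟩
    refine hπ.isCharacter hφ (op_apply_of_coeff_mul_coeff_comm hπ hξ e fun i j s =>
      coeff_mul_coeff_comm μ (fun f => ⟨U f, fun i => ?_⟩) i j s 1)
    refine HasWeakStarSum.mem_span_of_rankOne ?_ i
    rw [← hU]
    exact thetaHat_spec μ π ξ e _
  · rintro ⟨χ, hχ⟩
    have h1 : ∀ s, ‖φ s‖ = 1 := fun s => by rw [hχ, Circle.norm_coe]
    have hm : MemLp φ ∞ μ :=
      memLp_top_of_bound hφ.1.aestronglyMeasurable 1 (.of_forall fun s => (h1 s).le)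
    exact ⟨mulOp hm.toLp, mulOp_toLp_mem_unitary hm h1, thetaHat_eq_conj μ hξ
      (kraus_eq_smul μ (fun s => hπ.op_apply_of_norm_eq_one hξ (h1 s)) hφ.2.1.map_inv hm e)⟩
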